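/- A locale is a complete lattice $L$ in which $a\wedge\bigvee B=\bigvee_{b\in B}(a\wedge b)$ for all $a\in L$, $B\subseteq L$; a localic map $f:L\to M$ is a meet-preserving map whose left adjoint preserves finite meets; $\mathsf{Loc}$ is the category of locales and localic maps. A localic map $f:L\to M$ is closed if $f(\uparrow a)=\uparrow f(a)$ for all $a\in L$. A locale $L$ is strongly Hausdorff if its diagonal $L\to L\times L$ in $\mathsf{Loc}$ is closed, and compact if every $A\subseteq L$ with $\bigvee A=1$ has a finite subset $F$ with $\bigvee F=1$. Let $\mathsf{HLoc}$ be the full subcategory of $\mathsf{Loc}$ of strongly Hausdorff locales, $\mathsf{KHLoc}$ the full subcategory of $\mathsf{HLoc}$ of compact strongly Hausdorff locales, and $J:\mathsf{KHLoc}\to\mathsf{HLoc}$ the inclusion functor. **Proposition.** The functor $J$ has a pointwise left Kan extension along itself, and hence a density comonad. That is: for every $L\in\mathsf{HLoc}$ the functor $\mathsf{KHLoc}/L\to\mathsf{HLoc}$, $(\sigma:K\to L)\mapsto K$, has a colimit, and there are a comonad $(T,\epsilon,\delta)$ on $\mathsf{HLoc}$ and a natural transformation $\eta:J\Rightarrow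 TJ$ such that $(T,\eta)$ is a pointwise left Kan extension of $J$ along itself, $\epsilon J\circ\eta=1_J$ and $\delta J\circ\eta=T\eta\circ\eta$. -/

import Mathlib

open CategoryTheory Limits

universe u

/-! ### Binary products of locales

A locale is a frame, and a localic map `L ⟶ M` is recorded in `Locale = Frmᵒᵖ` by its left adjoint,
a frame homomorphism `M → L`. The product of two locales is the coproduct of the underlying frames,
which is built below as the frame of lower subsets of `L × M` that are closed under joins in either
variable. -/

namespace LocaleProd

variable {L M N : Type u} [Order.Frame L] [Order.Frame M] [Order.Frame N]

/-- Lower sets of `L × M` that are closed under joins in each variable separately. -/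
def IsCIdeal (U : LowerSet (L × M)) : Prop :=
  (∀ (A : Set L) (b : M), (∀ a ∈ A, (a, b) ∈ U) → (sSup A, b) ∈ U) ∧
  (∀ (a : L) (B : Set M), (∀ b ∈ B, (a, b) ∈ U) → (a, sSup B) ∈ U)

theorem mem_mono (U : LowerSet (L × M)) {a a' : L} {b b' : M} (ha : a ≤ a') (hb : b ≤ b')
    (h : (a', b') ∈ U) : (a, b) ∈ U :=
  U.lower (show (a, b) ≤ (a', b') from ⟨ha, hb⟩) h

theorem mem_himp_iff (U V : LowerSet (L × M)) (p : L × M) :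
    p ∈ U ⇨ V ↔ ∀ q ≤ p, q ∈ U → q ∈ V := by
  rw [← LowerSet.Iic_le, le_himp_iff]
  constructor
  · intro h q hq hU
    exact h ⟨hq, hU⟩
  · rintro h q ⟨hq, hU⟩
    exact h q hq hU

variable (L M) in
/-- The frame coproduct of `L` and `M`, as a sublocale of the frame of lower sets of `L × M`. -/
def frameCoprod : Sublocale (LowerSet (L × M)) where
  carrier := {U | IsCIdeal U}
  sInf_mem' S hS := by
    constructor
    · intro A b h
      rw [LowerSet.mem_sInf_iff]
      intro U hU
      exact (hS hU).1 A b fun a ha => LowerSet.mem_sInf_iff.1 (h a ha) U hU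
    · intro a B h
      rw [LowerSet.mem_sInf_iff]
      intro U hU
      exact (hS hU).2 a B fun b hb => LowerSet.mem_sInf_iff.1 (h b hb) U hU
  himp_mem' U V hV := by
    constructor
    · intro A b h
      rw [mem_himp_iff]
      rintro ⟨x, y⟩ ⟨hx, hy⟩ hU
      have e : x = sSup ((fun a => x ⊓ a) '' A) := by
        rw [sSup_image, ← inf_sSup_eq, inf_eq_left.2 hx]
      rw [e]
      refine hV.1 _ _ ?_
      rintro _ ⟨a, ha, rfl⟩
      exact (mem_himp_iff U V _).1 (h a ha) (x ⊓ a, y) ⟨inf_le_right, hy⟩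
        (mem_mono U inf_le_left le_rfl hU)
    · intro a B h
      rw [mem_himp_iff]
      rintro ⟨x, y⟩ ⟨hx, hy⟩ hU
      have e : y = sSup ((fun b => y ⊓ b) '' B) := by
        rw [sSup_image, ← inf_sSup_eq, inf_eq_left.2 hy]
      rw [e]
      refine hV.2 _ _ ?_
      rintro _ ⟨b, hb, rfl⟩
      exact (mem_himp_iff U V _).1 (h b hb) (x, y ⊓ b) ⟨hx, inf_le_right⟩
        (mem_mono U le_rfl inf_le_left hU)

theorem bot_left_mem (U : frameCoprod L M) (b : M) : ((⊥ : L), b) ∈ U.1 := by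
  have := U.2.1 ∅ b (by simp)
  rwa [sSup_empty] at this

theorem bot_right_mem (U : frameCoprod L M) (a : L) : (a, (⊥ : M)) ∈ U.1 := by
  have := U.2.2 a ∅ (by simp)
  rwa [sSup_empty] at this

/-- The pure tensor `a ⊗ b`. -/
def tensor (a : L) (b : M) : frameCoprod L M :=
  ⟨⟨{p | (p.1 ≤ a ∧ p.2 ≤ b) ∨ p.1 = ⊥ ∨ p.2 = ⊥}, by
      rintro ⟨x, y⟩ ⟨x', y'⟩ ⟨h₁, h₂⟩ h
      change (x' ≤ a ∧ y' ≤ b) ∨ x' = ⊥ ∨ y' = ⊥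
      change (x ≤ a ∧ y ≤ b) ∨ x = ⊥ ∨ y = ⊥ at h
      rcases h with ⟨h, h'⟩ | h | h
      · exact Or.inl ⟨h₁.trans h, h₂.trans h'⟩
      · exact Or.inr (Or.inl (le_bot_iff.1 (h ▸ h₁)))
      · exact Or.inr (Or.inr (le_bot_iff.1 (h ▸ h₂)))⟩, by
    constructor
    · intro A y h
      change (sSup A ≤ a ∧ y ≤ b) ∨ sSup A = ⊥ ∨ y = ⊥
      have h' : ∀ x ∈ A, (x ≤ a ∧ y ≤ b) ∨ x = ⊥ ∨ y = ⊥ := h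
      by_cases hy : y = ⊥
      · exact Or.inr (Or.inr hy)
      by_cases hyb : y ≤ b
      · refine Or.inl ⟨sSup_le fun x hx => ?_, hyb⟩
        rcases h' x hx with h | h | h
        · exact h.1
        · simp [h]
        · exact absurd h hy
      · refine Or.inr (Or.inl (sSup_eq_bot.2 fun x hx => ?_))
        rcases h' x hx with h | h | h
        · exact absurd h.2 hyb
        · exact h
        · exact absurd h hy
    · intro x B h
      change (x ≤ a ∧ sSup B ≤ b) ∨ x = ⊥ ∨ sSup B = ⊥
      have h' : ∀ y ∈ B, (x ≤ a ∧ y ≤ b) ∨ x = ⊥ ∨ y = ⊥ := h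
      by_cases hx : x = ⊥
      · exact Or.inr (Or.inl hx)
      by_cases hxa : x ≤ a
      · refine Or.inl ⟨hxa, sSup_le fun y hy => ?_⟩
        rcases h' y hy with h | h | h
        · exact h.2
        · exact absurd h hx
        · simp [h]
      · refine Or.inr (Or.inr (sSup_eq_bot.2 fun y hy => ?_))
        rcases h' y hy with h | h | h
        · exact absurd h.1 hxa
        · exact absurd h hx
        · exact h⟩

theorem mem_tensor (a : L) (b : M) (p : L × M) :
    p ∈ (tensor a b).1 ↔ (p.1 ≤ a ∧ p.2 ≤ b) ∨ p.1 = ⊥ ∨ p.2 = ⊥ := Iff.rfl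

theorem tensor_le_iff (a : L) (b : M) (U : frameCoprod L M) : tensor a b ≤ U ↔ (a, b) ∈ U.1 := by
  constructor
  · intro h
    exact h (show (a, b) ∈ (tensor a b).1 from Or.inl ⟨le_rfl, le_rfl⟩)
  · rintro h ⟨x, y⟩ (⟨hx, hy⟩ | hx | hy)
    · exact U.1.lower ⟨hx, hy⟩ h
    · obtain rfl : x = ⊥ := hx
      exact bot_left_mem U y
    · obtain rfl : y = ⊥ := hy
      exact bot_right_mem U x

theorem tensor_inf (a a' : L) (b b' : M) :
    tensor (a ⊓ a') (b ⊓ b') = tensor a b ⊓ tensor a' b' := by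
  apply le_antisymm
  · rw [tensor_le_iff]
    exact ⟨Or.inl ⟨inf_le_left, inf_le_left⟩, Or.inl ⟨inf_le_right, inf_le_right⟩⟩
  · rintro ⟨x, y⟩ ⟨h | h, h' | h'⟩
    · exact Or.inl ⟨le_inf h.1 h'.1, le_inf h.2 h'.2⟩
    · exact Or.inr h'
    · exact Or.inr h
    · exact Or.inr h

theorem tensor_top : tensor (⊤ : L) (⊤ : M) = ⊤ :=
  top_le_iff.1 fun _ _ => Or.inl ⟨le_top, le_top⟩

theorem eq_iSup_tensor (U : frameCoprod L M) : U = ⨆ p : U.1, tensor p.1.1 p.1.2 := by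
  apply le_antisymm
  · rintro ⟨a, b⟩ h
    exact (tensor_le_iff a b _).1 (le_iSup (fun p : U.1 => tensor p.1.1 p.1.2) ⟨(a, b), h⟩)
  · exact iSup_le fun p => (tensor_le_iff _ _ _).2 p.2

/-- The first coproduct injection `a ↦ a ⊗ ⊤`. -/
def inl : FrameHom L (frameCoprod L M) where
  toFun a := tensor a ⊤
  map_inf' a a' := by rw [← tensor_inf, inf_idem]
  map_top' := tensor_top
  map_sSup' A := by
    refine eq_of_forall_ge_iff fun U => ?_
    rw [tensor_le_iff, sSup_le_iff]
    simp only [Set.forall_mem_image, tensor_le_iff]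
    exact ⟨fun h a ha => mem_mono U.1 (le_sSup ha) le_rfl h, fun h => U.2.1 A _ fun a ha => h ha⟩

/-- The second coproduct injection `b ↦ ⊤ ⊗ b`. -/
def inr : FrameHom M (frameCoprod L M) where
  toFun b := tensor ⊤ b
  map_inf' b b' := by rw [← tensor_inf, inf_idem]
  map_top' := tensor_top
  map_sSup' B := by
    refine eq_of_forall_ge_iff fun U => ?_
    rw [tensor_le_iff, sSup_le_iff]
    simp only [Set.forall_mem_image, tensor_le_iff]
    exact ⟨fun h b hb => mem_mono U.1 le_rfl (le_sSup hb) h, fun h => U.2.2 _ B fun b hb => h hb⟩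

theorem inl_inf_inr (a : L) (b : M) : (inl a : frameCoprod L M) ⊓ inr b = tensor a b := by
  change tensor a ⊤ ⊓ tensor ⊤ b = _
  rw [← tensor_inf, inf_top_eq, top_inf_eq]

/-- The value at `U` of the frame homomorphism `frameCoprod L M → N` induced by `f` and `g`. -/
def descFun (f : FrameHom L N) (g : FrameHom M N) (U : frameCoprod L M) : N :=
  ⨆ p : U.1, f p.1.1 ⊓ g p.1.2

theorem descFun_le_iff (f : FrameHom L N) (g : FrameHom M N) (U : frameCoprod L M) (n : N) :
    descFun f g U ≤ n ↔ ∀ p ∈ U.1, f p.1 ⊓ g p.2 ≤ n := by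
  simp only [descFun, iSup_le_iff]
  exact ⟨fun h p hp => h ⟨p, hp⟩, fun h p => h p.1 p.2⟩

/-- The right adjoint of `descFun f g`. -/
def descAdj (f : FrameHom L N) (g : FrameHom M N) (n : N) : frameCoprod L M :=
  ⟨⟨{p | f p.1 ⊓ g p.2 ≤ n}, fun _ _ h hp =>
      (inf_le_inf (OrderHomClass.mono f h.1) (OrderHomClass.mono g h.2)).trans hp⟩, by
    constructor
    · intro A b h
      change f (sSup A) ⊓ g b ≤ n
      rw [map_sSup, sSup_inf_eq]
      simp only [iSup_le_iff, Set.forall_mem_image]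
      exact fun a ha => h a ha
    · intro a B h
      change f a ⊓ g (sSup B) ≤ n
      rw [map_sSup, inf_sSup_eq]
      simp only [iSup_le_iff, Set.forall_mem_image]
      exact fun b hb => h b hb⟩

theorem desc_gc (f : FrameHom L N) (g : FrameHom M N) :
    GaloisConnection (descFun f g) (descAdj f g) := fun U n => by
  rw [descFun_le_iff]
  rfl

theorem descFun_tensor (f : FrameHom L N) (g : FrameHom M N) (a : L) (b : M) :
    descFun f g (tensor a b) = f a ⊓ g b := by
  refine eq_of_forall_ge_iff fun n => ?_
  rw [desc_gc f g (tensor a b) n, tensor_le_iff]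
  rfl

/-- The frame homomorphism `frameCoprod L M → N` induced by `f : L → N` and `g : M → N`. -/
def desc (f : FrameHom L N) (g : FrameHom M N) : FrameHom (frameCoprod L M) N where
  toFun := descFun f g
  map_inf' U V := by
    apply le_antisymm
    · exact le_inf ((desc_gc f g).monotone_l inf_le_left) ((desc_gc f g).monotone_l inf_le_right)
    · unfold descFun
      rw [iSup_inf_iSup]
      refine iSup_le ?_
      rintro ⟨⟨⟨a, b⟩, hp⟩, ⟨⟨a', b'⟩, hq⟩⟩
      have hm : (a ⊓ a', b ⊓ b') ∈ (U ⊓ V).1 :=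
        ⟨U.1.lower ⟨inf_le_left, inf_le_left⟩ hp, V.1.lower ⟨inf_le_right, inf_le_right⟩ hq⟩
      refine le_trans (le_of_eq ?_)
        (le_iSup (fun p : (U ⊓ V).1 => f p.1.1 ⊓ g p.1.2) ⟨(a ⊓ a', b ⊓ b'), hm⟩)
      simp only [map_inf]
      exact inf_inf_inf_comm _ _ _ _
  map_top' := by
    rw [← tensor_top, descFun_tensor, map_top, map_top, inf_top_eq]
  map_sSup' S := by
    rw [(desc_gc f g).l_sSup, sSup_image]

theorem desc_inl (f : FrameHom L N) (g : FrameHom M N) : (desc f g).comp inl = f :=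
  FrameHom.ext fun a => (descFun_tensor f g a ⊤).trans (by rw [map_top, inf_top_eq])

theorem desc_inr (f : FrameHom L N) (g : FrameHom M N) : (desc f g).comp inr = g :=
  FrameHom.ext fun b => (descFun_tensor f g ⊤ b).trans (by rw [map_top, top_inf_eq])

theorem hom_ext {h k : FrameHom (frameCoprod L M) N} (h₁ : h.comp inl = k.comp inl)
    (h₂ : h.comp inr = k.comp inr) : h = k := by
  refine FrameHom.ext fun U => ?_
  rw [eq_iSup_tensor U, map_iSup, map_iSup]
  congr 1
  funext p
  rw [← inl_inf_inr, map_inf, map_inf]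
  exact congrArg₂ _ (DFunLike.congr_fun h₁ p.1.1) (DFunLike.congr_fun h₂ p.1.2)

/-- `frameCoprod L M` is the coproduct of `L` and `M` in the category of frames. -/
def frameCoprodIsColimit (L M : Frm.{u}) :
    IsColimit (BinaryCofan.mk (P := Frm.of (frameCoprod L M)) (Frm.ofHom inl) (Frm.ofHom inr)) :=
  BinaryCofan.IsColimit.mk _ (fun f g => Frm.ofHom (desc f.hom g.hom))
    (fun f g => Frm.hom_ext (desc_inl f.hom g.hom))
    (fun f g => Frm.hom_ext (desc_inr f.hom g.hom))
    (fun f g _ h₁ h₂ => Frm.hom_ext (hom_ext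
      ((congrArg Frm.Hom.hom h₁).trans (desc_inl f.hom g.hom).symm)
      ((congrArg Frm.Hom.hom h₂).trans (desc_inr f.hom g.hom).symm)))

end LocaleProd

instance Frm.hasBinaryCoproducts : HasBinaryCoproducts Frm.{u} :=
  haveI (L M : Frm.{u}) : HasColimit (pair L M) := ⟨⟨⟨_, LocaleProd.frameCoprodIsColimit L M⟩⟩⟩
  hasBinaryCoproducts_of_hasColimit_pair _

instance Locale.hasBinaryProducts : HasBinaryProducts Locale.{u} :=
  inferInstanceAs (HasBinaryProducts Frm.{u}ᵒᵖ)

/-! ### Strongly Hausdorff and compact locales -/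

namespace Locale

/-- The left adjoint `f^*` of a localic map `f`. -/
def preimage {L M : Locale.{u}} (f : L ⟶ M) : FrameHom M L :=
  Frm.Hom.hom f.unop

/-- The localic map `f` itself, as a function `L → M`: the right adjoint of `preimage f`. -/
def directImage {L M : Locale.{u}} (f : L ⟶ M) (a : L) : M :=
  sSup {b : M | preimage f b ≤ a}

theorem gc_directImage {L M : Locale.{u}} (f : L ⟶ M) :
    GaloisConnection (preimage f) (directImage f) := by
  intro b a
  constructor
  · exact fun h => le_sSup h
  · intro h
    refine (OrderHomClass.mono (preimage f) h).trans ?_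
    rw [directImage, map_sSup]
    exact sSup_le (by rintro _ ⟨c, hc, rfl⟩; exact hc)

/-- A localic map is closed if it sends every closed sublocale `↑a` to a closed sublocale,
necessarily `↑(f a)`. -/
def IsClosedMap {L M : Locale.{u}} (f : L ⟶ M) : Prop :=
  ∀ a : L, directImage f '' Set.Ici a = Set.Ici (directImage f a)

/-- A locale is strongly Hausdorff if its diagonal in the category of locales is closed. -/
def IsStronglyHausdorff (L : Locale.{u}) : Prop :=
  IsClosedMap (Limits.diag L)

/-- A locale is compact if every cover of it has a finite subcover. -/
def IsCompact (L : Locale.{u}) : Prop :=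
  ∀ A : Set L, sSup A = ⊤ → ∃ F : Set L, F ⊆ A ∧ F.Finite ∧ sSup F = ⊤

end Locale

/-- The category of strongly Hausdorff locales, a full subcategory of the category of locales. -/
abbrev HLoc : Type (u + 1) :=
  ObjectProperty.FullSubcategory (C := Locale.{u}) Locale.IsStronglyHausdorff

/-- The strongly Hausdorff locales which are compact. -/
def HLoc.isCompact : ObjectProperty HLoc.{u} :=
  fun L => Locale.IsCompact L.obj

/-- The category of compact strongly Hausdorff locales, a full subcategory of `HLoc`. -/
abbrev KHLoc : Type (u + 1) :=
  HLoc.isCompact.{u}.FullSubcategory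

/-- The inclusion functor `J : KHLoc ⥤ HLoc`. -/
abbrev KHLoc.inclusion : KHLoc.{u} ⥤ HLoc.{u} :=
  HLoc.isCompact.{u}.ι

/-! ### Density comonads -/

/-- A density comonad of `F : A ⥤ B`: a pointwise left Kan extension `(T, η)` of `F` along itself,
with the comonad structure `(T, ε, δ)` in which `ε` corresponds to `1_F : F ⟶ F` and `δ` to
`Tη ∘ η : F ⟶ TTF` under the universal property of `(T, η)`. -/
structure DensityComonad {A B : Type*} [Category* A] [Category* B] (F : A ⥤ B) where
  /-- The comonad `(T, ε, δ)`. -/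
  comonad : Comonad B
  /-- The natural transformation `η : F ⟶ TF`. -/
  unit : F ⟶ F ⋙ comonad.toFunctor
  /-- `(T, η)` is a pointwise left Kan extension of `F` along itself. -/
  isPointwise : (Functor.LeftExtension.mk comonad.toFunctor unit).IsPointwiseLeftKanExtension
  /-- `εF ∘ η = 1_F`. -/
  unit_counit : ∀ X : A, unit.app X ≫ comonad.ε.app (F.obj X) = 𝟙 (F.obj X)
  /-- `δF ∘ η = Tη ∘ η`. -/
  unit_comult : ∀ X : A, unit.app X ≫ comonad.δ.app (F.obj X) =
    unit.app X ≫ comonad.toFunctor.map (unit.app X)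

/-! ### Subframes -/

/-! The colimit over `KHLoc/L` exists for two reasons.

First, a diagram in `HLoc` has a colimit as soon as it has a small weakly final family of objects. A
cocone is then determined by its components at this family, so its vertex maps, on the frame side,
into one small product of frames. The subframe generated by the images of all cocones is the frame
of the colimit. It is separated because closedness of the diagonal amounts to `IsSeparatedFrame`: if
`f x ⊓ g y ≤ u` for all disjoint `x`, `y`, then `f ≤ g ⊔ u`. The elements satisfying `f a ≤ g a ⊔ u`
form a subframe, so the property passes from the generating images to the whole
(`IsSeparatedFrame.of_closure`).

Second, `KHLoc/L` has such a family: `K ⟶ L` factors through its image, whose frame is a subframe of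
that of `K`, hence compact, and a quotient of that of `L`, hence separated. Images are determined by
their kernels, which are subsets of `L × L` and so form a small set.

The comonad laws are then formal consequences of the universal property of the Kan extension. -/

/-- A subset of a frame closed under finite meets and arbitrary joins. -/
structure Subframe (L : Type u) [Order.Frame L] where
  /-- The underlying set. -/
  carrier : Set L
  top_mem : ⊤ ∈ carrier
  inf_mem : ∀ {a b}, a ∈ carrier → b ∈ carrier → a ⊓ b ∈ carrier
  sSup_mem : ∀ {A : Set L}, A ⊆ carrier → sSup A ∈ carrier

namespace Subframe

variable {L M N : Type u} [Order.Frame L] [Order.Frame M] [Order.Frame N]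

instance (S : Subframe L) : SupSet S.carrier :=
  ⟨fun A => ⟨sSup (Subtype.val '' A), S.sSup_mem (by rintro _ ⟨a, _, rfl⟩; exact a.2)⟩⟩

instance (S : Subframe L) : CompleteLattice S.carrier where
  __ := completeLatticeOfSup S.carrier fun A =>
    ⟨fun a ha => show a.1 ≤ sSup (Subtype.val '' A) from le_sSup ⟨a, ha, rfl⟩,
      fun b hb => show sSup (Subtype.val '' A) ≤ b.1 from
        sSup_le (by rintro _ ⟨a, ha, rfl⟩; exact hb ha)⟩
  inf a b := ⟨a.1 ⊓ b.1, S.inf_mem a.2 b.2⟩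
  inf_le_left a b := show a.1 ⊓ b.1 ≤ a.1 from inf_le_left
  inf_le_right a b := show a.1 ⊓ b.1 ≤ b.1 from inf_le_right
  le_inf a b c hb hc := show a.1 ≤ b.1 ⊓ c.1 from le_inf hb hc
  top := ⟨⊤, S.top_mem⟩
  le_top a := show a.1 ≤ ⊤ from le_top

instance (S : Subframe L) : Order.Frame S.carrier :=
  Order.Frame.ofMinimalAxioms
    { inf_sSup_le_iSup_inf := fun a A => by
        change a.1 ⊓ sSup (Subtype.val '' A) ≤ (⨆ b ∈ A, a ⊓ b).1
        rw [inf_sSup_eq]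
        refine iSup₂_le ?_
        rintro _ ⟨b, hb, rfl⟩
        exact le_iSup₂ (f := fun b (_ : b ∈ A) => a ⊓ b) b hb }

/-- The inclusion of a subframe. -/
def subtype (S : Subframe L) : FrameHom S.carrier L where
  toFun := Subtype.val
  map_inf' _ _ := rfl
  map_top' := rfl
  map_sSup' _ := rfl

/-- A frame homomorphism with values in a subframe, as a homomorphism to this subframe. -/
def codRestrict (S : Subframe M) (f : FrameHom L M) (h : ∀ a, f a ∈ S.carrier) :
    FrameHom L S.carrier where
  toFun a := ⟨f a, h a⟩
  map_inf' a b := Subtype.ext (map_inf f a b)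
  map_top' := Subtype.ext (map_top f)
  map_sSup' A := Subtype.ext <| (map_sSup f A).trans <|
    congrArg sSup (Set.image_image Subtype.val (fun a => (⟨f a, h a⟩ : S.carrier)) A).symm

/-- The range of a frame homomorphism. -/
def range (f : FrameHom L M) : Subframe M where
  carrier := Set.range f
  top_mem := ⟨⊤, map_top f⟩
  inf_mem := by
    rintro _ _ ⟨a, rfl⟩ ⟨b, rfl⟩
    exact ⟨a ⊓ b, map_inf f a b⟩
  sSup_mem {A} hA := ⟨sSup (f ⁻¹' A), by rw [map_sSup, Set.image_preimage_eq_of_subset hA]⟩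

/-- The subframe generated by a set. -/
def closure (X : Set L) : Subframe L where
  carrier := {a | ∀ S : Subframe L, X ⊆ S.carrier → a ∈ S.carrier}
  top_mem S _ := S.top_mem
  inf_mem ha hb S h := S.inf_mem (ha S h) (hb S h)
  sSup_mem hA S h := S.sSup_mem fun _ ha => hA ha S h

theorem subset_closure (X : Set L) : X ⊆ (closure X).carrier := fun _ ha _ h => h ha

/-- The image of a subframe under a frame homomorphism. -/
def map (f : FrameHom L M) (S : Subframe L) : Subframe M :=
  range (f.comp S.subtype)

/-- To show that all elements of `closure X` lie in a subframe of `closure X`, it suffices to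
consider the elements of `X`. -/
theorem mem_of_closure {X : Set L} (T : Subframe (closure X).carrier)
    (h : ∀ (a : L) (ha : a ∈ X), (⟨a, subset_closure X ha⟩ : (closure X).carrier) ∈ T.carrier)
    (a : (closure X).carrier) : a ∈ T.carrier := by
  -- The closure is tested against subframes of `L`, so `T` is first pushed forward along the
  -- inclusion.
  obtain ⟨b, hb⟩ := a.2 (map (closure X).subtype T) fun x hx => ⟨⟨_, h x hx⟩, rfl⟩
  obtain rfl : b.1 = a := Subtype.ext hb
  exact b.2

/-- The subframe on which `f ≤ g ⊔ u`. -/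
def leSup (f g : FrameHom L M) (u : M) : Subframe L where
  carrier := {a | f a ≤ g a ⊔ u}
  top_mem := by simp
  inf_mem {a b} ha hb := by
    change f (a ⊓ b) ≤ g (a ⊓ b) ⊔ u
    rw [map_inf, map_inf, sup_inf_right]
    exact inf_le_inf ha hb
  sSup_mem {A} hA := by
    change f (sSup A) ≤ g (sSup A) ⊔ u
    rw [map_sSup, sSup_le_iff]
    rintro _ ⟨a, ha, rfl⟩
    exact (hA ha).trans (sup_le_sup_right (OrderHomClass.mono g (le_sSup ha)) u)

/-- The subframe on which two frame homomorphisms agree. -/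
def eqLocus (f g : FrameHom L M) : Subframe L where
  carrier := {a | f a = g a}
  top_mem := by simp
  inf_mem {a b} ha hb := by
    change f (a ⊓ b) = g (a ⊓ b)
    rw [map_inf, map_inf, show f a = g a from ha, show f b = g b from hb]
  sSup_mem {A} hA := by
    change f (sSup A) = g (sSup A)
    rw [map_sSup, map_sSup, Set.image_congr hA]

end Subframe

/-- A surjective frame homomorphism `q` is a quotient map: every `f` which identifies
the elements identified by `q` factors through `q`. -/
theorem FrameHom.exists_comp_eq {L M N : Type u} [Order.Frame L] [Order.Frame M] [Order.Frame N]
    (q : FrameHom L M) (hq : Function.Surjective q) (f : FrameHom L N)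
    (h : ∀ a b, q a = q b → f a = f b) : ∃ g : FrameHom M N, g.comp q = f := by
  have hs := Function.surjInv_eq hq
  refine ⟨⟨⟨⟨fun m => f (Function.surjInv hq m), fun a b => ?_⟩, ?_⟩, fun A => ?_⟩,
    FrameHom.ext fun a => h _ _ (hs _)⟩
  · rw [← map_inf]
    exact h _ _ (by rw [map_inf, hs, hs, hs])
  · refine (h _ ⊤ ?_).trans (map_top f)
    rw [map_top]; exact hs _
  · change f _ = sSup ((fun m => f (Function.surjInv hq m)) '' A)
    rw [← Set.image_image f (Function.surjInv hq), ← map_sSup]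
    refine h _ _ ?_
    rw [map_sSup, Set.image_image, hs]
    simp [hs]

/-! ### Strongly Hausdorff locales in terms of frame homomorphisms -/

/-- The frame-theoretic separation property expressing that the diagonal is closed. -/
def IsSeparatedFrame (L : Type u) [Order.Frame L] : Prop :=
  ∀ (N : Type u) [Order.Frame N] (f g : FrameHom L N) (u : N),
    (∀ x y, x ⊓ y = ⊥ → f x ⊓ g y ≤ u) → ∀ a, f a ≤ g a ⊔ u

/-- A frame generated by images of separated frames is separated. -/
theorem IsSeparatedFrame.of_closure {L : Type u} [Order.Frame L] (X : Set L)
    (h : ∀ a (ha : a ∈ X), ∃ (M : Type u) (_ : Order.Frame M)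
      (q : FrameHom M (Subframe.closure X).carrier),
      IsSeparatedFrame M ∧ ⟨a, Subframe.subset_closure X ha⟩ ∈ Set.range q) :
    IsSeparatedFrame (Subframe.closure X).carrier := by
  intro N _ f g u hfg
  refine Subframe.mem_of_closure (Subframe.leSup f g u) fun a ha => ?_
  obtain ⟨M, _, q, hM, m, hm⟩ := h a ha
  rw [← hm]
  exact hM N (f.comp q) (g.comp q) u (fun x y hxy => hfg (q x) (q y) (by
    rw [← map_inf, hxy, map_bot])) m

/-- Homomorphisms out of `M` are tested after composition with `q`, which preserves disjointness. In
localic terms, sublocales inherit the Hausdorff property. -/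
theorem IsSeparatedFrame.of_surjective {L M : Type u} [Order.Frame L] [Order.Frame M]
    (hL : IsSeparatedFrame L) (q : FrameHom L M) (hq : Function.Surjective q) :
    IsSeparatedFrame M := by
  intro N _ f g u hfg a
  obtain ⟨a, rfl⟩ := hq a
  exact hL N (f.comp q) (g.comp q) u (fun x y hxy => hfg (q x) (q y) (by
    rw [← map_inf, hxy, map_bot])) a

/-! ### Closed diagonals and the separation property -/

namespace Locale

variable {L M : Locale.{u}}

theorem preimage_injective {f g : L ⟶ M} (h : preimage f = preimage g) : f = g :=
  Quiver.Hom.unop_inj (Frm.hom_ext h)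

/-- The localic map with a given left adjoint. -/
def homOf (f : FrameHom M L) : L ⟶ M :=
  (show M.unop ⟶ L.unop from Frm.ofHom f).op

/-- Transports the decomposition into pure tensors from `frameCoprod` to the chosen product. The
comparison map `e` sends tensors to rectangles, and a section `r` of it suffices. -/
theorem eq_sSup_prod (b : (L ⨯ M : Locale.{u})) :
    b = sSup {c | ∃ x y, c = preimage (prod.fst : L ⨯ M ⟶ L) x ⊓
      preimage (prod.snd : L ⨯ M ⟶ M) y ∧ c ≤ b} := by
  let C := LocaleProd.frameCoprod L M
  let e : FrameHom C (L ⨯ M : Locale.{u}) :=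
    LocaleProd.desc (preimage (prod.fst : L ⨯ M ⟶ L)) (preimage (prod.snd : L ⨯ M ⟶ M))
  let r : FrameHom (L ⨯ M : Locale.{u}) C :=
    preimage (L := Locale.of C)
      (prod.lift (homOf (L := Locale.of C) LocaleProd.inl) (homOf (L := Locale.of C) LocaleProd.inr))
  have her : e.comp r = FrameHom.id _ := by
    have : homOf (M := Locale.of C) e ≫
        prod.lift (homOf (L := Locale.of C) LocaleProd.inl)
          (homOf (L := Locale.of C) LocaleProd.inr) =
        𝟙 (L ⨯ M : Locale.{u}) := by
      apply Limits.prod.hom_ext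
      · rw [Category.assoc, prod.lift_fst, Category.id_comp]
        exact preimage_injective (LocaleProd.desc_inl _ _)
      · rw [Category.assoc, prod.lift_snd, Category.id_comp]
        exact preimage_injective (LocaleProd.desc_inr _ _)
    exact congrArg preimage this
  have hb : e (r b) = b := DFunLike.congr_fun her b
  apply le_antisymm
  · conv_lhs => rw [← hb, LocaleProd.eq_iSup_tensor (r b), map_iSup]
    refine iSup_le fun p => le_sSup ⟨p.1.1, p.1.2, LocaleProd.descFun_tensor _ _ _ _, ?_⟩
    conv_rhs => rw [← hb]
    exact OrderHomClass.mono e ((LocaleProd.tensor_le_iff _ _ _).2 p.2)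
  · exact sSup_le (by rintro c ⟨x, y, -, h⟩; exact h)

theorem preimage_diag_fst (a : L) :
    preimage (Limits.diag L) (preimage (prod.fst : L ⨯ L ⟶ L) a) = a :=
  DFunLike.congr_fun (congrArg preimage (prod.lift_fst (𝟙 L) (𝟙 L))) a

theorem preimage_diag_snd (a : L) :
    preimage (Limits.diag L) (preimage (prod.snd : L ⨯ L ⟶ L) a) = a :=
  DFunLike.congr_fun (congrArg preimage (prod.lift_snd (𝟙 L) (𝟙 L))) a

/-- The element `D = directImage (diag L) ⊥` is the join of the rectangles on disjoint pairs, so the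
pairing `h` of `f` and `g` sends it below `u`. Closedness makes `p₂ a ⊔ D` a direct image, which
yields `p₁ a ≤ p₂ a ⊔ D`; applying `h` gives the claim. -/
theorem IsStronglyHausdorff.isSeparatedFrame (hL : IsStronglyHausdorff L) :
    IsSeparatedFrame L := by
  intro N _ f g u hfg
  set p₁ := preimage (prod.fst : L ⨯ L ⟶ L)
  set p₂ := preimage (prod.snd : L ⨯ L ⟶ L)
  set d := preimage (Limits.diag L)
  have gc : GaloisConnection d (directImage (Limits.diag L)) := gc_directImage _
  let h : FrameHom (L ⨯ L : Locale.{u}) N :=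
    preimage (L := Locale.of N) (prod.lift (homOf f) (homOf g))
  have h₁ : ∀ a, h (p₁ a) = f a := fun a =>
    DFunLike.congr_fun (congrArg preimage (prod.lift_fst (X := L) (Y := L)
      (homOf (L := Locale.of N) f) (homOf g))) a
  have h₂ : ∀ a, h (p₂ a) = g a := fun a =>
    DFunLike.congr_fun (congrArg preimage (prod.lift_snd (X := L) (Y := L)
      (homOf (L := Locale.of N) f) (homOf g))) a
  have hD : h (directImage (Limits.diag L) ⊥) ≤ u := by
    rw [eq_sSup_prod (directImage (Limits.diag L) ⊥), map_sSup]
    refine sSup_le ?_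
    rintro _ ⟨_, ⟨x, y, rfl, hxy⟩, rfl⟩
    rw [← gc, map_inf, preimage_diag_fst, preimage_diag_snd, le_bot_iff] at hxy
    rw [map_inf, h₁, h₂]
    exact hfg x y hxy
  intro a
  obtain ⟨c, -, hc⟩ := (hL ⊥).ge (show directImage (Limits.diag L) ⊥ ≤
    p₂ a ⊔ directImage (Limits.diag L) ⊥ from le_sup_right)
  have hac : a ≤ c := by
    have : d (p₂ a) ≤ c := (gc _ _).2 (hc ▸ le_sup_left)
    rwa [preimage_diag_snd] at this
  have h3 : p₁ a ≤ p₂ a ⊔ directImage (Limits.diag L) ⊥ := by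
    rw [← hc, ← gc, preimage_diag_fst]
    exact hac
  have h4 := OrderHomClass.mono h h3
  rw [h₁, map_sup, h₂] at h4
  exact h4.trans (sup_le_sup_left hD _)

/-- Separation applied to the two coproduct injections shows that they agree modulo any `U` above a
direct image. Modulo `U`, a rectangle `p₁ x ⊓ p₂ y` is therefore the same as `p₁ (x ⊓ y)`, so `U` is
determined by its restriction `d U` to the diagonal. -/
theorem isStronglyHausdorff_of_isSeparatedFrame (hL : IsSeparatedFrame L) :
    IsStronglyHausdorff L := by
  intro a
  set p₁ := preimage (prod.fst : L ⨯ L ⟶ L) with hp₁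
  set p₂ := preimage (prod.snd : L ⨯ L ⟶ L)
  set d := preimage (Limits.diag L) with hd
  have gc : GaloisConnection d (directImage (Limits.diag L)) := gc_directImage _
  apply Set.Subset.antisymm
  · rintro _ ⟨b, hb, rfl⟩
    exact gc.monotone_u hb
  intro U hU
  have hU' : directImage (Limits.diag L) a ≤ U := hU
  have hxy : ∀ x y : L, x ⊓ y = ⊥ → p₁ x ⊓ p₂ y ≤ U := fun x y h => by
    refine le_trans ((gc _ _).1 ?_) hU'
    rw [map_inf, preimage_diag_fst, preimage_diag_snd, h]
    exact bot_le
  have h12 : ∀ x, p₁ x ≤ p₂ x ⊔ U := hL _ p₁ p₂ U hxy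
  have h21 : ∀ x, p₂ x ≤ p₁ x ⊔ U := hL _ p₂ p₁ U fun x y h => by
    rw [inf_comm]; exact hxy y x (by rw [inf_comm, h])
  have key : p₁ (d U) ≤ U := by
    rw [eq_sSup_prod U, map_sSup, map_sSup]
    refine sSup_le ?_
    rintro _ ⟨_, ⟨_, ⟨x, y, rfl, h⟩, rfl⟩, rfl⟩
    -- The expansion of `U` also affected the right-hand side, which is folded back here.
    rw [← eq_sSup_prod U, map_inf, preimage_diag_fst, preimage_diag_snd, map_inf]
    calc p₁ x ⊓ p₁ y ≤ p₁ x ⊓ (p₂ y ⊔ U) := inf_le_inf_left _ (h12 y)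
      _ ≤ U := by
        rw [inf_sup_left]
        exact sup_le h inf_le_right
  -- Since `d` is surjective, `d U` is the only element that can have direct image `U`.
  refine ⟨d U, ?_, le_antisymm ?_ ((gc _ _).1 le_rfl)⟩
  · have : p₁ a ≤ U := le_trans ((gc _ _).1 (preimage_diag_fst a).le) hU'
    simpa only [preimage_diag_fst, hd, hp₁, Set.mem_Ici] using OrderHomClass.mono d this
  · rw [eq_sSup_prod (directImage (Limits.diag L) (d U))]
    refine sSup_le ?_
    rintro _ ⟨x, y, rfl, h⟩
    rw [← gc, map_inf, preimage_diag_fst, preimage_diag_snd] at h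
    calc p₁ x ⊓ p₂ y ≤ p₁ x ⊓ (p₁ y ⊔ U) := inf_le_inf_left _ (h21 y)
      _ ≤ U := by
        rw [inf_sup_left, ← map_inf]
        exact sup_le ((OrderHomClass.mono p₁ h).trans key) inf_le_right

end Locale
/-! ### Colimits of strongly Hausdorff locales -/

theorem Locale.isStronglyHausdorff_iff {L : Locale.{u}} :
    IsStronglyHausdorff L ↔ IsSeparatedFrame L :=
  ⟨IsStronglyHausdorff.isSeparatedFrame, isStronglyHausdorff_of_isSeparatedFrame⟩

/-- The frame homomorphism into a product of frames with given components. -/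
def FrameHom.pi {ι L : Type u} [Order.Frame L] {M : ι → Type u} [∀ i, Order.Frame (M i)]
    (f : ∀ i, FrameHom L (M i)) : FrameHom L (∀ i, M i) where
  toFun a i := f i a
  map_inf' a b := funext fun i => map_inf (f i) a b
  map_top' := funext fun i => map_top (f i)
  map_sSup' A := funext fun i => by
    rw [map_sSup, sSup_image, sSup_apply, iSup_subtype, iSup_image]

/-- The projections of a product of frames. -/
def FrameHom.proj {ι : Type u} (M : ι → Type u) [∀ i, Order.Frame (M i)] (i : ι) :
    FrameHom (∀ i, M i) (M i) where
  toFun x := x i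
  map_inf' _ _ := rfl
  map_top' := rfl
  map_sSup' A := by rw [sSup_apply, sSup_image, iSup_subtype]

namespace HLoc

/-- The strongly Hausdorff locale of a separated frame. -/
def of (L : Type u) [Order.Frame L] (hL : IsSeparatedFrame L) : HLoc.{u} :=
  ⟨Locale.of L, Locale.isStronglyHausdorff_iff.2 hL⟩

theorem isSeparatedFrame (L : HLoc.{u}) : IsSeparatedFrame L.obj :=
  Locale.isStronglyHausdorff_iff.1 L.property

/-- The left adjoint of a morphism of strongly Hausdorff locales. -/
def preimage {L M : HLoc.{u}} (f : L ⟶ M) : FrameHom M.obj L.obj :=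
  Locale.preimage f.hom

/-- The morphism with a given left adjoint. -/
def homOf {L M : HLoc.{u}} (f : FrameHom M.obj L.obj) : L ⟶ M :=
  ObjectProperty.homMk (Locale.homOf f)

theorem preimage_injective {L M : HLoc.{u}} {f g : L ⟶ M} (h : preimage f = preimage g) :
    f = g :=
  ObjectProperty.hom_ext _ (Locale.preimage_injective h)

theorem preimage_comp_apply {K L M : HLoc.{u}} (f : K ⟶ L) (g : L ⟶ M) (a : M.obj) :
    preimage (f ≫ g) a = preimage f (preimage g a) := rfl

section Colimit

universe v w

variable {J : Type w} [Category.{v} J] (F : J ⥤ HLoc.{u}) {I : Type u} (obj : I → J)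

/-- The frame homomorphism from the vertex of a cocone to the product of the frames of the
diagram at a family of objects. -/
def coconeHom (c : Cocone F) : FrameHom c.pt.obj (∀ i, (F.obj (obj i)).obj) :=
  FrameHom.pi fun i => preimage (c.ι.app (obj i))

/-- The elements of the product which come from some cocone. -/
def coconeSet : Set (∀ i, (F.obj (obj i)).obj) :=
  {x | ∃ c : Cocone F, x ∈ Set.range (coconeHom F obj c)}

/-- The frame of the colimit: the subframe generated by the images of all cocones. -/
abbrev colimitFrame : Type u := (Subframe.closure (coconeSet F obj)).carrier

/-- Each generator lies in the image of the separated frame of a cocone vertex. This is why the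
frame is generated by cocones in `HLoc` instead of consisting of all compatible families, for which
separation is not evident. -/
theorem isSeparatedFrame_colimitFrame : IsSeparatedFrame (colimitFrame F obj) := by
  refine IsSeparatedFrame.of_closure _ fun x hx => ?_
  obtain ⟨c, a, rfl⟩ := hx
  exact ⟨c.pt.obj, inferInstance,
    Subframe.codRestrict _ (coconeHom F obj c)
      fun a => Subframe.subset_closure _ ⟨c, a, rfl⟩, c.pt.isSeparatedFrame, a, rfl⟩

variable (k : J → I) (φ : ∀ j, j ⟶ obj (k j))

/-- The components of the colimit cocone. -/
def colimitLeg (j : J) : FrameHom (colimitFrame F obj) (F.obj j).obj :=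
  (preimage (F.map (φ j))).comp
    ((FrameHom.proj (fun i => (F.obj (obj i)).obj) (k j)).comp (Subframe.subtype _))

/-- Naturality of `c` along `φ j` removes the dependence on the arbitrary choices `k` and `φ`.
Identities between legs can thus be checked on the generators. -/
theorem colimitLeg_apply (j : J) (c : Cocone F) (a : c.pt.obj)
    (h : coconeHom F obj c a ∈ (Subframe.closure (coconeSet F obj)).carrier) :
    colimitLeg F obj k φ j ⟨coconeHom F obj c a, h⟩ = preimage (c.ι.app j) a := by
  rw [← c.w (φ j), preimage_comp_apply]
  rfl

theorem colimitLeg_comp {j j' : J} (f : j ⟶ j') :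
    (preimage (F.map f)).comp (colimitLeg F obj k φ j') = colimitLeg F obj k φ j := by
  refine FrameHom.ext fun x => Subframe.mem_of_closure (Subframe.eqLocus
    ((preimage (F.map f)).comp (colimitLeg F obj k φ j')) (colimitLeg F obj k φ j)) ?_ x
  rintro _ ⟨c, a, rfl⟩
  change preimage (F.map f) (colimitLeg F obj k φ j' _) = colimitLeg F obj k φ j _
  rw [colimitLeg_apply, colimitLeg_apply, ← c.w f, preimage_comp_apply]

/-- The index `k (obj i)` may differ from `i`, yet the leg is the `i`-th coordinate, since both
agree on generators. Hence the legs determine an element, which gives uniqueness in the universal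
property. -/
theorem colimitLeg_obj (i : I) (x : colimitFrame F obj) :
    colimitLeg F obj k φ (obj i) x = x.1 i := by
  refine Subframe.mem_of_closure (Subframe.eqLocus (colimitLeg F obj k φ (obj i))
    ((FrameHom.proj (fun i => (F.obj (obj i)).obj) i).comp (Subframe.subtype _))) ?_ x
  rintro _ ⟨c, a, rfl⟩
  exact colimitLeg_apply F obj k φ (obj i) c a _

/-- The colimit cocone. -/
def colimitCocone : Cocone F where
  pt := HLoc.of (colimitFrame F obj) (isSeparatedFrame_colimitFrame F obj)
  ι :=
    { app := fun j => homOf (M := HLoc.of _ (isSeparatedFrame_colimitFrame F obj))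
        (colimitLeg F obj k φ j)
      naturality := fun _ _ f => preimage_injective (colimitLeg_comp F obj k φ f) }

/-- The colimit cocone is a colimit. -/
def colimitCoconeIsColimit : IsColimit (colimitCocone F obj k φ) where
  desc c := homOf (L := HLoc.of _ (isSeparatedFrame_colimitFrame F obj)) <|
    Subframe.codRestrict _ (coconeHom F obj c) fun a => Subframe.subset_closure _ ⟨c, a, rfl⟩
  fac c j := preimage_injective <| FrameHom.ext fun a => colimitLeg_apply F obj k φ j c a _
  uniq _ _ hm := preimage_injective <| FrameHom.ext fun a => Subtype.ext <| funext fun i =>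
    (colimitLeg_obj F obj k φ i _).symm.trans
      (DFunLike.congr_fun (congrArg preimage (hm (obj i))) a)

end Colimit

/-- A diagram of strongly Hausdorff locales has a colimit if it has a small weakly final family
of objects. -/
theorem hasColimit_of_weaklyFinal {J : Type*} [Category* J] (F : J ⥤ HLoc.{u}) {I : Type u}
    (obj : I → J) (h : ∀ j, ∃ i, Nonempty (j ⟶ obj i)) : HasColimit F := by
  choose k φ using h
  exact ⟨⟨⟨_, colimitCoconeIsColimit F obj k fun j => (φ j).some⟩⟩⟩

end HLoc

/-! ### Compact strongly Hausdorff locales over a strongly Hausdorff locale -/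

namespace KHLoc

/-- `Y` is the image of `X` in `L`: its frame is the range of the left adjoint of `X`, with the same
kernel. -/
theorem exists_surjective_factorization {L : HLoc.{u}} (X : CostructuredArrow KHLoc.inclusion.{u} L) :
    ∃ Y : CostructuredArrow KHLoc.inclusion.{u} L,
      Function.Surjective (HLoc.preimage Y.hom) ∧
      ∀ a b, HLoc.preimage Y.hom a = HLoc.preimage Y.hom b ↔
        HLoc.preimage X.hom a = HLoc.preimage X.hom b := by
  let S := Subframe.range (HLoc.preimage X.hom)
  let q : FrameHom L.obj S.carrier := Subframe.codRestrict S (HLoc.preimage X.hom) fun a => ⟨a, rfl⟩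
  have hq : Function.Surjective q := by
    rintro ⟨_, a, rfl⟩
    exact ⟨a, rfl⟩
  let H : HLoc.{u} := HLoc.of S.carrier (L.isSeparatedFrame.of_surjective q hq)
  let K : KHLoc.{u} := ⟨H, by
    intro A hA
    -- Joins in the subframe are those of the ambient frame, so a cover in the range is a cover of
    -- the compact locale `X.left`.
    obtain ⟨G, hGA, hG, hG'⟩ := X.left.property (Subtype.val '' A) (congrArg Subtype.val hA)
    refine ⟨Subtype.val ⁻¹' G, ?_, hG.preimage Subtype.val_injective.injOn, Subtype.ext ?_⟩
    · intro a ha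
      obtain ⟨b, hb, hab⟩ := hGA ha
      rwa [← Subtype.ext hab]
    · refine Eq.trans ?_ hG'
      change sSup (Subtype.val '' (Subtype.val ⁻¹' G)) = sSup G
      rw [Set.image_preimage_eq_of_subset]
      intro x hx
      obtain ⟨b, hb, hab⟩ := hGA hx
      exact ⟨b, hab⟩⟩
  refine ⟨CostructuredArrow.mk (Y := K) (HLoc.homOf (L := H) q), hq, fun a b => ?_⟩
  exact Subtype.ext_iff

/-- A surjective left adjoint is a quotient map of frames, so inclusion of kernels gives the
factorization over `L`. -/
theorem nonempty_hom {L : HLoc.{u}} (X Y : CostructuredArrow KHLoc.inclusion.{u} L)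
    (hY : Function.Surjective (HLoc.preimage Y.hom))
    (h : ∀ a b, HLoc.preimage Y.hom a = HLoc.preimage Y.hom b →
        HLoc.preimage X.hom a = HLoc.preimage X.hom b) : Nonempty (X ⟶ Y) := by
  obtain ⟨g, hg⟩ := FrameHom.exists_comp_eq _ hY _ h
  exact ⟨CostructuredArrow.homMk
    (ObjectProperty.homMk (HLoc.homOf (L := X.left.obj) (M := Y.left.obj) g))
    (HLoc.preimage_injective hg)⟩

theorem hasPointwiseLeftKanExtension_inclusion :
    KHLoc.inclusion.{u}.HasPointwiseLeftKanExtension KHLoc.inclusion.{u} := by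
  intro L
  let kernel (X : CostructuredArrow KHLoc.inclusion.{u} L) : Set (L.obj × L.obj) :=
    {p | HLoc.preimage X.hom p.1 = HLoc.preimage X.hom p.2}
  -- The comma category is large, but indexing by kernels keeps `I` in `Type u`; one object is
  -- chosen for each kernel.
  let I := {r : Set (L.obj × L.obj) // ∃ Y, Function.Surjective (HLoc.preimage Y.hom) ∧
    kernel Y = r}
  refine HLoc.hasColimit_of_weaklyFinal _ (fun r : I => r.2.choose) fun X => ?_
  obtain ⟨Y, hY, hYX⟩ := exists_surjective_factorization X
  let r : I := ⟨kernel Y, Y, hY, rfl⟩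
  refine ⟨r, nonempty_hom _ _ r.2.choose_spec.1 fun a b hab => (hYX a b).1 ?_⟩
  -- The chosen object may differ from `Y`, but it has the same kernel.
  exact r.2.choose_spec.2.le (show (a, b) ∈ kernel r.2.choose from hab)

end KHLoc

/-! ### Density comonads from pointwise left Kan extensions -/

namespace DensityComonad

universe v₁ v₂ u₁ u₂
variable {A : Type u₁} {B : Type u₂} [Category.{v₁} A] [Category.{v₂} B] {F : A ⥤ B}

theorem hom_ext (T : B ⥤ B) (η : F ⟶ F ⋙ T) [T.IsLeftKanExtension η] {G : B ⥤ B}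
    {α β : T ⟶ G} (h : ∀ X, η.app X ≫ α.app (F.obj X) = η.app X ≫ β.app (F.obj X)) : α = β :=
  T.hom_ext_of_isLeftKanExtension η _ _ (NatTrans.ext (funext h))

/-- The comultiplication of the density comonad. -/
noncomputable def comult (T : B ⥤ B) (η : F ⟶ F ⋙ T) [T.IsLeftKanExtension η] : T ⟶ T ⋙ T :=
  T.descOfIsLeftKanExtension η (T ⋙ T) (η ≫ Functor.whiskerRight η T)

/-- The density comonad on a left Kan extension of `F` along itself. -/
noncomputable def comonadOfIsLeftKanExtension (T : B ⥤ B) (η : F ⟶ F ⋙ T)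
    [T.IsLeftKanExtension η] : Comonad B where
  toFunctor := T
  ε := T.descOfIsLeftKanExtension η (𝟭 B) F.rightUnitor.inv
  δ := comult T η
  coassoc X := by
    -- Each comonad law equates two transformations out of `T`, so it suffices to compare them after
    -- precomposition with `η`.
    have h := hom_ext T η (α := comult T η ≫
        Functor.whiskerRight (comult T η) T)
      (β := comult T η ≫
        Functor.whiskerLeft T (comult T η))
      fun X => by
        simp [comult, ← Functor.map_comp]
    exact NatTrans.congr_app h X
  left_counit X := by
    have h := hom_ext T η (α := comult T η ≫
        Functor.whiskerLeft T (T.descOfIsLeftKanExtension η (𝟭 B) F.rightUnitor.inv))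
      (β := 𝟙 T) fun X => by
        simp [comult]
    exact NatTrans.congr_app h X
  right_counit X := by
    have h := hom_ext T η (α := comult T η ≫
        Functor.whiskerRight (T.descOfIsLeftKanExtension η (𝟭 B) F.rightUnitor.inv) T)
      (β := 𝟙 T) fun X => by
        simp [comult, ← Functor.map_comp]
    exact NatTrans.congr_app h X

theorem nonempty_of_hasPointwiseLeftKanExtension (F : A ⥤ B)
    [F.HasPointwiseLeftKanExtension F] : Nonempty (DensityComonad F) :=
  ⟨{ comonad := comonadOfIsLeftKanExtension (F.pointwiseLeftKanExtension F)
        (F.pointwiseLeftKanExtensionUnit F)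
     unit := F.pointwiseLeftKanExtensionUnit F
     isPointwise := F.pointwiseLeftKanExtensionIsPointwiseLeftKanExtension F
     unit_counit := fun X => Functor.descOfIsLeftKanExtension_fac_app _ _ _ _ X
     unit_comult := fun X => Functor.descOfIsLeftKanExtension_fac_app _ _ _ _ X }⟩

end DensityComonad

theorem mainTheorem7 :
    KHLoc.inclusion.{u}.HasPointwiseLeftKanExtension KHLoc.inclusion.{u} ∧
      Nonempty (DensityComonad KHLoc.inclusion.{u}) := by
  have := KHLoc.hasPointwiseLeftKanExtension_inclusion.{u}
  exact ⟨this, DensityComonad.nonempty_of_hasPointwiseLeftKanExtension _⟩
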